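/- Let $\lambda$ be the uniform (fair coin) measure on $\{0,1\}^{\mathbb N}$. A Martin-Löf test is a computable sequence $\mathcal U=(U_n)_{n\in\mathbb N}$ of open subsets of $\{0,1\}^{\mathbb N}$ with $\lambda(U_n)\le 2^{-n}$ for all $n$ (the sets need not be nested); it is universal if $\bigcap_n V_n\subseteq\bigcap_n U_n$ for every Martin-Löf test $(V_n)_n$. Let $\mathrm{MLR}$ be the set of Martin-Löf random sequences, i.e. of those that lie in $\bigcap_n V_n$ for no Martin-Löf test $(V_n)_n$; equivalently, the complement of $\bigcap_n U_n$ for any universal test. Consider the following multivalued functions between represented spaces: - $\mathrm{LAY}_{\mathcal U}:\mathrm{MLR}\rightrightarrows\mathbb N$, with $n\in\mathrm{LAY}_{\mathcal U}(p)$ iff $p\notin U_n$; - $\mathrm{RD}_{\mathcal U}:\mathrm{MLR}\to\mathbb N$, with $\mathrm{RD}_{\mathcal U}(p)=\min\{n\in\mathbb N: p\notin U_n\}$; - $\mathrm C_{\mathbb N}:\subseteq\mathcal A(\mathbb N)\rightrightarrows\mathbb N$, with $n\in\mathrm C_{\mathbb N}(A)$ iff $n\in A$, defined on the nonempty $A\subseteq\mathbb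 N$, where $q\in\mathbb N^{\mathbb N}$ is a name of $A$ iff for all $n$: $n\notin A\Leftrightarrow\exists i\; q(i)=n+1$; - $d_{\mathrm{MLR}}:\mathrm{MLR}\to\{1\}$, the unique map, where $\mathrm{MLR}\subseteq\{0,1\}^{\mathbb N}\subseteq\mathbb N^{\mathbb N}$ is represented by the identity. Here $f$ is Weihrauch reducible to $g$ if there are computable $K,H:\subseteq\mathbb N^{\mathbb N}\to\mathbb N^{\mathbb N}$ such that $p\mapsto K\langle p,G(H(p))\rangle$ is a realizer of $f$ for every realizer $G$ of $g$; Weihrauch equivalence $\equiv_{\mathrm W}$ is reducibility in both directions. Then for every universal Martin-Löf test $\mathcal U$, $$\mathrm{LAY}_{\mathcal U}\equiv_{\mathrm W}\mathrm{RD}_{\mathcal U}\equiv_{\mathrm W}\mathrm C_{\mathbb N}\times d_{\mathrm{MLR}},$$ and also $\mathrm{LAY}_{\mathcal U}\equiv_{\mathrm W}\mathrm C_{\mathbb N}\times d_{\mathrm{MLR}}$. Consequently, for all universal Martin-Löf tests $\mathcal U$ and $\mathcal V$, $\mathrm{LAY}_{\mathcal U}\equiv_{\mathrm W}\mathrm{LAY}_{\mathcal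 V}$ and $\mathrm{RD}_{\mathcal U}\equiv_{\mathrm W}\mathrm{RD}_{\mathcal V}$. -/

import Mathlib

open scoped ENNReal

namespace LayerProblem

/-! ### Computable functions on Baire space -/

/-- Baire space `ℕ^ℕ`. -/
abbrev Baire : Type := ℕ → ℕ

/-- Partial recursive functionals, i.e. the partial functions `(p, n) ↦ Φ^p(n)` computed by an
oracle machine that has the sequence `p` as its oracle. This is the version of `Nat.RecursiveIn`
that is uniform in the oracle: one and the same program works for all `p`. -/
inductive RecFunctional : (Baire → ℕ →. ℕ) → Prop
  | zero : RecFunctional fun _ _ => Part.some 0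
  | succ : RecFunctional fun _ n => Part.some (n + 1)
  | left : RecFunctional fun _ n => Part.some n.unpair.1
  | right : RecFunctional fun _ n => Part.some n.unpair.2
  | oracle : RecFunctional fun p n => Part.some (p n)
  | pair {Φ Ψ : Baire → ℕ →. ℕ} (hΦ : RecFunctional Φ) (hΨ : RecFunctional Ψ) :
      RecFunctional fun p n => (Nat.pair <$> Φ p n <*> Ψ p n)
  | comp {Φ Ψ : Baire → ℕ →. ℕ} (hΦ : RecFunctional Φ) (hΨ : RecFunctional Ψ) :
      RecFunctional fun p n => (Ψ p n >>= Φ p)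
  | prec {Φ Ψ : Baire → ℕ →. ℕ} (hΦ : RecFunctional Φ) (hΨ : RecFunctional Ψ) :
      RecFunctional fun p a =>
        a.unpair.2.rec (Φ p a.unpair.1) fun y IH => do
          let i ← IH
          Ψ p (Nat.pair a.unpair.1 (Nat.pair y i))
  | rfind {Φ : Baire → ℕ →. ℕ} (hΦ : RecFunctional Φ) :
      RecFunctional fun p a =>
        Nat.rfind fun n => (fun m => decide (m = 0)) <$> Φ p (Nat.pair a n)

/-- A partial function `F : ⊆ ℕ^ℕ → ℕ^ℕ` is computable if a single oracle machine produces, for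
every `p ∈ dom F` and every `n`, the value `F(p)(n)` from the oracle `p` and the input `n`. -/
def ComputableBaire (F : Baire →. Baire) : Prop :=
  ∃ Φ : Baire → ℕ →. ℕ, RecFunctional Φ ∧ ∀ p, ∀ q ∈ F p, ∀ n, q n ∈ Φ p n

/-- The standard pairing `⟨p, q⟩ = (p 0, q 0, p 1, q 1, …)` on Baire space. -/
def pairing (p q : Baire) : Baire := fun n => if n % 2 = 0 then p (n / 2) else q (n / 2)

/-- The first component of a pair. -/
def pairFst (r : Baire) : Baire := fun n => r (2 * n)

/-- The second component of a pair. -/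
def pairSnd (r : Baire) : Baire := fun n => r (2 * n + 1)

theorem pairFst_pairing (p q : Baire) : pairFst (pairing p q) = p := by
  funext n
  simp [pairFst, pairing]

theorem pairSnd_pairing (p q : Baire) : pairSnd (pairing p q) = q := by
  funext n
  have h : (2 * n + 1) / 2 = n := by omega
  simp [pairSnd, pairing, Nat.add_mod, h]

/-! ### Represented spaces, multivalued functions, Weihrauch reducibility -/

/-- A represented space: a set with a partial surjection from Baire space onto it. -/
structure RepSpace where
  /-- The underlying set. -/
  carrier : Type
  /-- The representation; `x ∈ rep p` says that `p` is a name of `x`. -/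
  rep : Baire →. carrier
  /-- Every point has a name. -/
  surj : ∀ x, ∃ p, x ∈ rep p

/-- A (partial) multivalued function between represented spaces, given by its sets of values;
its domain is the set of the points with at least one value. -/
def MultiFun (X Y : RepSpace) : Type := X.carrier → Set Y.carrier

/-- The domain of a multivalued function. -/
def MultiFun.dom {X Y : RepSpace} (f : MultiFun X Y) : Set X.carrier := {x | (f x).Nonempty}

/-- `F ⊢ f`: `F` maps every name of every `x ∈ dom f` to a name of some value of `f` at `x`. -/
def Realizes {X Y : RepSpace} (F : Baire →. Baire) (f : MultiFun X Y) : Prop :=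
  ∀ p, ∀ x ∈ X.rep p, x ∈ f.dom → ∃ q ∈ F p, ∃ y ∈ Y.rep q, y ∈ f x

/-- Weihrauch reducibility: there are computable `K`, `H` such that `p ↦ K⟨p, G(H(p))⟩` realizes
`f` whenever `G` realizes `g`. -/
def WeihrauchLE {X Y Z W : RepSpace} (f : MultiFun X Y) (g : MultiFun Z W) : Prop :=
  ∃ K H : Baire →. Baire, ComputableBaire K ∧ ComputableBaire H ∧
    ∀ G : Baire →. Baire, Realizes G g →
      Realizes (fun p => (H p).bind fun h => (G h).bind fun r => K (pairing p r)) f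

/-- Weihrauch equivalence. -/
def WeihrauchEquiv {X Y Z W : RepSpace} (f : MultiFun X Y) (g : MultiFun Z W) : Prop :=
  WeihrauchLE f g ∧ WeihrauchLE g f

/-- The product of represented spaces. -/
abbrev RepSpace.prod (X Y : RepSpace) : RepSpace where
  carrier := X.carrier × Y.carrier
  rep := fun r => (X.rep (pairFst r)).bind fun x => (Y.rep (pairSnd r)).map fun y => (x, y)
  surj := by
    rintro ⟨x, y⟩
    obtain ⟨p, hp⟩ := X.surj x
    obtain ⟨q, hq⟩ := Y.surj y
    refine ⟨pairing p q, Part.mem_bind ?_ (Part.mem_map _ ?_)⟩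
    · rw [pairFst_pairing]; exact hp
    · rw [pairSnd_pairing]; exact hq

/-- The product of multivalued functions, `(f × g)(x, z) = f(x) × g(z)`. -/
def MultiFun.prod {X Y Z W : RepSpace} (f : MultiFun X Y) (g : MultiFun Z W) :
    MultiFun (X.prod Z) (Y.prod W) :=
  fun x => f x.1 ×ˢ g x.2

/-- The subspace of a represented space: names are inherited. -/
abbrev RepSpace.sub (X : RepSpace) (S : Set X.carrier) : RepSpace where
  carrier := S
  rep := fun p => ⟨∃ h : (X.rep p).Dom, (X.rep p).get h ∈ S, fun h => ⟨(X.rep p).get h.1, h.2⟩⟩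
  surj := by
    rintro ⟨x, hx⟩
    obtain ⟨p, hd, rfl⟩ := X.surj x
    exact ⟨p, ⟨hd, hx⟩, rfl⟩

/-- Baire space, represented by the identity. -/
abbrev baireSpace : RepSpace where
  carrier := Baire
  rep := fun p => Part.some p
  surj := fun p => ⟨p, Part.mem_some p⟩

/-- The natural numbers; `p` is a name of `p 0`. -/
abbrev natSpace : RepSpace where
  carrier := ℕ
  rep := fun p => Part.some (p 0)
  surj := fun n => ⟨fun _ => n, Part.mem_some n⟩

/-- The space `𝒜(ℕ)` of the closed subsets of `ℕ`, given by negative information: `p` is a name of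
the set `A` with `n ∉ A ↔ ∃ i, p i = n + 1`. -/
abbrev closedNatSpace : RepSpace where
  carrier := Set ℕ
  rep := fun p => Part.some {n | ¬ ∃ i, p i = n + 1}
  surj := by
    classical
    intro A
    refine ⟨fun i => if i ∈ A then 0 else i + 1, Part.mem_some_iff.2 ?_⟩
    ext n
    constructor
    · rintro hn ⟨i, hi⟩
      by_cases h : i ∈ A
      · simp [h] at hi
      · simp only [h, if_false, Nat.add_right_cancel_iff] at hi
        exact h (hi ▸ hn)
    · intro hn
      by_contra h
      exact hn ⟨n, by simp [h]⟩

/-- Closed choice on the natural numbers: `n ∈ C_ℕ(A) ↔ n ∈ A`, with domain the nonempty sets. -/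
def closedChoiceNat : MultiFun closedNatSpace natSpace := fun A => A

/-- For `A ⊆ ℕ^ℕ`, the unique map `d_A : A → {1}`. -/
def dMap (A : Set Baire) : MultiFun (baireSpace.sub A) (natSpace.sub ({1} : Set ℕ)) :=
  fun _ => {⟨(1 : ℕ), (rfl : (1 : ℕ) = 1)⟩}

/-! ### Martin-Löf randomness on Cantor space -/

/-- Cantor space `{0,1}^ℕ`, with `false` for `0` and `true` for `1`. -/
abbrev Cantor : Type := ℕ → Bool

/-- The inclusion `{0,1}^ℕ ⊆ ℕ^ℕ`. -/
def Cantor.toBaire (x : Cantor) : Baire := fun n => (x n).toNat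

/-- Cantor space as a represented space: the name of `x` is `x` itself as a point of `ℕ^ℕ`. -/
abbrev cantorSpace : RepSpace where
  carrier := Cantor
  rep := fun p => ⟨∀ n, p n ≤ 1, fun _ n => decide (p n = 1)⟩
  surj := by
    intro x
    refine ⟨Cantor.toBaire x, fun n => Bool.toNat_le _, ?_⟩
    funext n
    cases h : x n <;> simp [Cantor.toBaire, h]

/-- The set `w{0,1}^ℕ` of the infinite sequences that begin with the word `w`. -/
def wordCylinder (w : List Bool) : Set Cantor := {x | ∀ i : Fin w.length, x i = w.get i}

/-- The uniform measure `λ` on Cantor space: the product of fair coin measures. -/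
noncomputable def cantorMeasure : MeasureTheory.Measure Cantor :=
  MeasureTheory.Measure.infinitePi fun _ : ℕ => (PMF.uniformOfFintype Bool).toMeasure

/-- A computable sequence of open sets: a single algorithm lists, given `i`, a finite or infinite
list of words whose cylinders have the union `U i` (`none` means that no word is listed in that
position). -/
def ComputableOpenSeq (U : ℕ → Set Cantor) : Prop :=
  ∃ e : ℕ → ℕ → Option (List Bool), Computable₂ e ∧
    ∀ i, U i = {x | ∃ j, ∃ w ∈ e i j, x ∈ wordCylinder w}

/-- Martin-Löf tests (not necessarily nested). -/
def IsMLTest (U : ℕ → Set Cantor) : Prop :=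
  ComputableOpenSeq U ∧ ∀ i, cantorMeasure (U i) ≤ (2⁻¹ : ℝ≥0∞) ^ i

/-- Universal Martin-Löf tests. -/
def IsUniversalMLTest (U : ℕ → Set Cantor) : Prop :=
  IsMLTest U ∧ ∀ V : ℕ → Set Cantor, IsMLTest V → (⋂ i, V i) ⊆ ⋂ i, U i

/-- The set of Martin-Löf random sequences, those that pass every test. -/
def MLR : Set Cantor := {x | ∀ V : ℕ → Set Cantor, IsMLTest V → x ∉ ⋂ i, V i}

/-- `MLR` is the complement of the intersection of any universal Martin-Löf test. -/
theorem MLR_eq_compl {U : ℕ → Set Cantor} (hU : IsUniversalMLTest U) : MLR = (⋂ i, U i)ᶜ := by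
  ext x
  exact ⟨fun h => h U hU.1, fun h V hV hx => h (hU.2 V hV hx)⟩

/-- The represented space of the Martin-Löf random sequences. -/
abbrev mlrSpace : RepSpace := cantorSpace.sub MLR

/-- `LAY_U : MLR ⇉ ℕ`, with `n ∈ LAY_U(x) ↔ x ∉ U n`. -/
def LAY (U : ℕ → Set Cantor) : MultiFun mlrSpace natSpace :=
  fun x => {n : ℕ | x.1 ∉ U n}

/-- `RD_U : MLR → ℕ`, where `RD_U(x)` is the least `n` with `x ∉ U n`. -/
def RD (U : ℕ → Set Cantor) : MultiFun mlrSpace natSpace :=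
  fun x => {n : ℕ | IsLeast {m : ℕ | x.1 ∉ U m} n}

/-- `d_MLR`, for `MLR` as a subset of Baire space. -/
def dMLR : MultiFun (baireSpace.sub (Cantor.toBaire '' MLR)) (natSpace.sub ({1} : Set ℕ)) :=
  dMap (Cantor.toBaire '' MLR)

end LayerProblem

/-!
All reductions go around the cycle `LAY U ≤ RD U ≤ C_ℕ × d_MLR ≤ LAY U`, and the remaining ones,
including those between two universal tests, follow by transitivity. Every reduction is witnessed by
total functionals `K` and `H`, so transitivity only needs the composition of total functionals
(`TotallyReducible.trans`).

The step `LAY U ≤ RD U` is trivial, because the least layer is a layer.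

For `RD U ≤ C_ℕ × d_MLR`, the condition "`n` is the least layer of `x`" is not co-enumerable in `x`,
but "`x ∉ U n`, and `x` is seen in `U i` by stage `s` for all `i < n`" is. Closed choice finds such a
pair `⟨n, s⟩`, and the random sequence itself is passed on to `d_MLR` (`RD_totallyReducible`).

For `C_ℕ × d_MLR ≤ LAY U`, a nonempty set `A` given by an enumeration of its complement has a
sequence of guesses `g 0, g 1, …` that is eventually constant with value in `A`
(`exists_guess_eq`). From a random `x` and these guesses a sequence `y` is produced bit by bit: copy
`x`, but write zeros as long as some earlier guess `g i` differs from the current one and the bits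
written so far do not yet force `y ∈ U i`. A sequence of zeros from some point on is not random
(`notMem_MLR_of_eq_false_from`), so by universality it lies in every open set `U i`; hence every
phase of zeros ends. There are finitely many of them, so `y` is a finite modification of `x` and
thus random (`mem_MLR_of_eq_from`, by invariance of the measure under flipping a bit), whereas
`y ∈ U i` for every wrong guess `g i` (`mem_MLR_of_pending`). So for any layer `n` of `y` the guess
`g n` is right.
-/

namespace LayerProblem

/-! ### Functionals computable uniformly in an oracle -/

theorem RecFunctional.of_partrec {f : ℕ →. ℕ} (hf : Nat.Partrec f) :
    RecFunctional fun _ n => f n := by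
  induction hf with
  | zero => exact .zero
  | succ => exact .succ
  | left => exact .left
  | right => exact .right
  | pair _ _ hf hg => exact .pair hf hg
  | comp _ _ hf hg => exact .comp hf hg
  | prec _ _ hf hg => exact .prec hf hg
  | rfind _ hf => exact .rfind hf

/-- The oracle may be replaced by a sequence that is computed from the oracle. -/
theorem RecFunctional.subst {Φ : Baire → ℕ →. ℕ} (hΦ : RecFunctional Φ) {ψ : Baire → Baire}
    (hψ : RecFunctional fun p n => Part.some (ψ p n)) : RecFunctional fun p => Φ (ψ p) := by
  induction hΦ with
  | zero => exact .zero
  | succ => exact .succ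
  | left => exact .left
  | right => exact .right
  | oracle => exact hψ
  | pair _ _ hf hg => exact .pair hf hg
  | comp _ _ hf hg => exact .comp hf hg
  | prec _ _ hf hg => exact .prec hf hg
  | rfind _ hf => exact .rfind hf

/-- A total functional `(p, a) ↦ φ p a` is oracle computable if a single oracle machine computes
the code of `φ p a` from the oracle `p` and the code of `a`. What the machine does on numbers that
are not codes is left free. -/
def OracleComputable {α β : Type*} [Primcodable α] [Primcodable β] (φ : Baire → α → β) : Prop :=
  ∃ Φ : Baire → ℕ →. ℕ, RecFunctional Φ ∧
    ∀ p a, Encodable.encode (φ p a) ∈ Φ p (Encodable.encode a)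

namespace OracleComputable

variable {α β γ δ σ : Type*} [Primcodable α] [Primcodable β] [Primcodable γ] [Primcodable δ]
  [Primcodable σ]

theorem of_computable {f : α → β} (hf : Computable f) : OracleComputable fun _ => f :=
  ⟨_, .of_partrec hf, fun _ a => by simp⟩

theorem comp {g : Baire → β → γ} {f : Baire → α → β} (hg : OracleComputable g)
    (hf : OracleComputable f) : OracleComputable fun p a => g p (f p a) := by
  obtain ⟨Γ, hΓ, hg⟩ := hg
  obtain ⟨Φ, hΦ, hf⟩ := hf
  exact ⟨_, .comp hΓ hΦ, fun p a => Part.mem_bind (hf p a) (hg p _)⟩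

theorem pair {f : Baire → α → β} {g : Baire → α → γ} (hf : OracleComputable f)
    (hg : OracleComputable g) : OracleComputable fun p a => (f p a, g p a) := by
  obtain ⟨Γ, hΓ, hg⟩ := hg
  obtain ⟨Φ, hΦ, hf⟩ := hf
  refine ⟨_, .pair hΦ hΓ, fun p a => ?_⟩
  rw [Part.eq_some_iff.2 (hf p a), Part.eq_some_iff.2 (hg p a)]
  simp [Seq.seq]

theorem comp₁ {f : β → γ} (hf : Computable f) {g : Baire → α → β} (hg : OracleComputable g) :
    OracleComputable fun p a => f (g p a) :=
  (of_computable hf).comp hg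

theorem comp₂ {f : β → γ → δ} (hf : Computable₂ f) {g : Baire → α → β} {h : Baire → α → γ}
    (hg : OracleComputable g) (hh : OracleComputable h) :
    OracleComputable fun p a => f (g p a) (h p a) :=
  (of_computable hf).comp (hg.pair hh)

theorem const (b : β) : OracleComputable fun (_ : Baire) (_ : α) => b :=
  of_computable (.const b)

theorem oracle {f : Baire → α → ℕ} (hf : OracleComputable f) :
    OracleComputable fun p a => p (f p a) :=
  comp (g := fun p n => p n) ⟨_, .oracle, fun _ _ => Part.mem_some _⟩ hf

theorem cond {c : Baire → α → Bool} {f g : Baire → α → β} (hc : OracleComputable c)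
    (hf : OracleComputable f) (hg : OracleComputable g) :
    OracleComputable fun p a => bif c p a then f p a else g p a :=
  (of_computable (f := fun x : Bool × β × β => bif x.1 then x.2.1 else x.2.2)
    (.cond .fst (Computable.fst.comp .snd) (Computable.snd.comp .snd))).comp (hc.pair (hf.pair hg))

theorem nat_rec {n : Baire → α → ℕ} {g : Baire → α → σ} {h : Baire → α × ℕ × σ → σ}
    (hn : OracleComputable n) (hg : OracleComputable g) (hh : OracleComputable h) :
    OracleComputable fun p a =>
      Nat.rec (motive := fun _ => σ) (g p a) (fun y IH => h p (a, y, IH)) (n p a) := by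
  have key : OracleComputable fun p (x : α × ℕ) =>
      Nat.rec (motive := fun _ => σ) (g p x.1) (fun y IH => h p (x.1, y, IH)) x.2 := by
    obtain ⟨Γ, hΓ, hg⟩ := hg
    obtain ⟨Φ, hΦ, hh⟩ := hh
    refine ⟨_, .prec hΓ hΦ, ?_⟩
    rintro p ⟨a, k⟩
    simp only [Encodable.encode_prod_val, Nat.unpair_pair, Encodable.encode_nat]
    induction k with
    | zero => exact hg p a
    | succ k ih => exact Part.mem_bind ih (by simpa using hh p (a, k, _))
  exact key.comp ((of_computable .id).pair hn)

theorem exists_lt {n : Baire → α → ℕ} {f : Baire → α × ℕ → Bool} (hn : OracleComputable n)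
    (hf : OracleComputable f) :
    OracleComputable fun p a => decide (∃ t < n p a, f p (a, t) = true) := by
  have h := nat_rec (h := fun p x => x.2.2 || f p (x.1, x.2.1)) hn (const (α := α) false)
    (comp₂ Primrec.or.to_comp (of_computable (Computable.snd.comp .snd))
      (hf.comp (of_computable (Computable.fst.pair (Computable.fst.comp .snd)))))
  convert h using 3 with p a
  generalize n p a = k
  induction k with
  | zero => simp
  | succ k ih =>
    simp only [← ih]
    rw [Bool.eq_iff_iff]
    simp [Nat.le_iff_lt_or_eq, or_and_right, exists_or]

theorem subst {φ : Baire → α → β} (hφ : OracleComputable φ) {ψ : Baire → Baire}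
    (hψ : OracleComputable ψ) : OracleComputable fun p a => φ (ψ p) a := by
  obtain ⟨Φ, hΦ, hφ⟩ := hφ
  obtain ⟨Ψ, hΨ, hψ⟩ := hψ
  have : Ψ = fun p n => Part.some (ψ p n) := by
    funext p n
    exact Part.eq_some_iff.2 (hψ p n)
  exact ⟨_, hΦ.subst (this ▸ hΨ), fun p a => hφ (ψ p) a⟩

theorem computableBaire {F : Baire → Baire} (hF : OracleComputable F) :
    ComputableBaire fun p => Part.some (F p) := by
  obtain ⟨Φ, hΦ, h⟩ := hF
  refine ⟨Φ, hΦ, fun p q hq n => ?_⟩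
  rw [Part.mem_some_iff.1 hq]
  exact h p n

theorem id : OracleComputable fun p : Baire => p :=
  oracle (of_computable .id)

theorem pairFst : OracleComputable pairFst :=
  oracle (of_computable (Primrec.nat_mul.comp (.const 2) .id).to_comp)

theorem pairSnd : OracleComputable pairSnd :=
  oracle (of_computable (Primrec.succ.comp (Primrec.nat_mul.comp (.const 2) .id)).to_comp)

theorem pairing {F G : Baire → Baire} (hF : OracleComputable F) (hG : OracleComputable G) :
    OracleComputable fun p => pairing (F p) (G p) := by
  have half : OracleComputable fun (_ : Baire) (n : ℕ) => n / 2 :=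
    of_computable (Primrec.nat_div.comp .id (.const 2)).to_comp
  have even : OracleComputable fun (_ : Baire) (n : ℕ) => decide (n % 2 = 0) :=
    of_computable
      (Primrec.eq.decide.comp (Primrec.nat_mod.comp .id (.const 2)) (.const 0)).to_comp
  convert even.cond (hF.comp half) (hG.comp half) using 3 with p n
  simp [LayerProblem.pairing, Bool.cond_decide]

end OracleComputable

/-! ### Reductions by total functionals -/

/-- Weihrauch reducibility witnessed by total functionals `K` and `H`, with the quantification over
realizers unfolded: `H` maps names of points of `dom f` to names of points of `dom g`, and `K` turns
any name of any value of `g` there into a name of a value of `f`. -/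
def TotallyReducible {X Y Z W : RepSpace} (f : MultiFun X Y) (g : MultiFun Z W) : Prop :=
  ∃ K H : Baire → Baire, OracleComputable K ∧ OracleComputable H ∧
    ∀ p, ∀ x ∈ X.rep p, x ∈ f.dom → ∃ z ∈ Z.rep (H p), z ∈ g.dom ∧
      ∀ q, ∀ y ∈ W.rep q, y ∈ g z → ∃ u ∈ Y.rep (K (pairing p q)), u ∈ f x

theorem TotallyReducible.weihrauchLE {X Y Z W : RepSpace} {f : MultiFun X Y} {g : MultiFun Z W}
    (h : TotallyReducible f g) : WeihrauchLE f g := by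
  obtain ⟨K, H, hK, hH, h⟩ := h
  refine ⟨_, _, hK.computableBaire, hH.computableBaire, fun G hG p x hx hxf => ?_⟩
  obtain ⟨z, hz, hzg, hKz⟩ := h p x hx hxf
  obtain ⟨q, hq, y, hy, hyg⟩ := hG _ z hz hzg
  exact ⟨_, Part.mem_bind (Part.mem_some _) (Part.mem_bind hq (Part.mem_some _)), hKz q y hy hyg⟩

theorem TotallyReducible.trans {X Y Z W S T : RepSpace} {f : MultiFun X Y} {g : MultiFun Z W}
    {h : MultiFun S T} (hfg : TotallyReducible f g) (hgh : TotallyReducible g h) :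
    TotallyReducible f h := by
  obtain ⟨K₁, H₁, hK₁, hH₁, h₁⟩ := hfg
  obtain ⟨K₂, H₂, hK₂, hH₂, h₂⟩ := hgh
  refine ⟨fun r => K₁ (pairing (pairFst r) (K₂ (pairing (H₁ (pairFst r)) (pairSnd r)))),
    fun p => H₂ (H₁ p), ?_, hH₂.subst hH₁, fun p x hx hxf => ?_⟩
  · exact hK₁.subst (.pairing .pairFst
      (hK₂.subst (.pairing (hH₁.subst .pairFst) .pairSnd)))
  · obtain ⟨z, hz, hzg, hKz⟩ := h₁ p x hx hxf
    obtain ⟨s, hs, hsh, hKs⟩ := h₂ _ z hz hzg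
    refine ⟨s, hs, hsh, fun q y hy hyh => ?_⟩
    obtain ⟨u, hu, hug⟩ := hKs q y hy hyh
    simpa only [pairFst_pairing, pairSnd_pairing] using hKz _ u hu hug

/-! ### Random sequences and finite modifications -/

instance : MeasureTheory.IsProbabilityMeasure (PMF.uniformOfFintype Bool).toMeasure :=
  PMF.toMeasure.isProbabilityMeasure _

theorem measurableSet_wordCylinder (w : List Bool) : MeasurableSet (wordCylinder w) := by
  simp only [wordCylinder, Set.ofPred_forall]
  exact .iInter fun i => measurableSet_eq_fun (measurable_pi_apply _) measurable_const

theorem ComputableOpenSeq.measurableSet {U : ℕ → Set Cantor} (hU : ComputableOpenSeq U) (i : ℕ) :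
    MeasurableSet (U i) := by
  obtain ⟨e, -, hU⟩ := hU
  have : U i = ⋃ j, ⋃ w ∈ {w | w ∈ e i j}, wordCylinder w := by
    rw [hU]; ext; simp
  rw [this]
  exact .iUnion fun j => .biUnion (Set.to_countable _) fun w _ => measurableSet_wordCylinder w

/-- The map that flips the bit in position `k`. -/
def flipBit (k : ℕ) (x : Cantor) : Cantor := fun n => if n = k then !x n else x n

theorem flipBit_mem_wordCylinder {k : ℕ} {x : Cantor} {w : List Bool} :
    flipBit k x ∈ wordCylinder w ↔ x ∈ wordCylinder (w.modify k not) := by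
  simp only [wordCylinder, Set.mem_ofPred_eq, Fin.forall_iff, List.length_modify,
    List.get_eq_getElem, List.getElem_modify, flipBit]
  refine forall₂_congr fun i hi => ?_
  by_cases h : k = i
  · subst h; simp
  · simp [h, Ne.symm h]

theorem measurePreserving_flipBit (k : ℕ) :
    MeasureTheory.MeasurePreserving (flipBit k) cantorMeasure cantorMeasure := by
  have hm : ∀ n : ℕ, Measurable fun b : Bool => if n = k then !b else b :=
    fun n => measurable_of_finite _
  refine ⟨measurable_pi_lambda _ fun n => (hm n).comp (measurable_pi_apply n), ?_⟩
  have h := MeasureTheory.Measure.infinitePi_map_pi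
    (fun _ : ℕ => (PMF.uniformOfFintype Bool).toMeasure) hm
  refine h.trans ?_
  rw [cantorMeasure]
  congr 1
  funext n
  rw [PMF.toMeasure_map (hf := hm n)]
  congr 1
  ext b
  by_cases hn : n = k <;> cases b <;> simp [hn, PMF.map_apply]

/-- Preimages under `flipBit k` turn tests into tests, since `flipBit k` preserves the measure and
acts computably on words. -/
theorem flipBit_mem_MLR (k : ℕ) {x : Cantor} (hx : x ∈ MLR) : flipBit k x ∈ MLR := by
  intro V hV hxV
  refine hx (fun i => flipBit k ⁻¹' V i) ⟨?_, fun i => ?_⟩ ?_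
  · obtain ⟨e, he, heV⟩ := hV.1
    refine ⟨fun i j => (e i j).map (·.modify k not), ?_, fun i => ?_⟩
    · have hm : Computable₂ fun (_ : ℕ × ℕ) (w : List Bool) => w.modify k not :=
        ((Primrec.list_modify Primrec.not).comp .snd (.const k)).to_comp
      exact Computable.option_map he hm
    · ext y
      simp [heV, flipBit_mem_wordCylinder]
  · rw [(measurePreserving_flipBit k).measure_preimage (hV.1.measurableSet i).nullMeasurableSet]
    exact hV.2 i
  · simpa using hxV

theorem mem_MLR_of_eq_from {N : ℕ} {x y : Cantor} (h : ∀ n ≥ N, x n = y n) (hx : x ∈ MLR) :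
    y ∈ MLR := by
  induction N generalizing x with
  | zero => rwa [← (funext fun n => h n (Nat.zero_le n) : x = y)]
  | succ N ih =>
    by_cases hN : x N = y N
    · exact ih (fun n hn => (Nat.eq_or_lt_of_le hn).elim (fun e => e ▸ hN) (h n)) hx
    · refine ih (x := flipBit N x) (fun n hn => ?_) (flipBit_mem_MLR N hx)
      rcases Nat.eq_or_lt_of_le hn with rfl | hn
      · simpa [flipBit] using (Bool.eq_not_of_ne (Ne.symm hN)).symm
      · simpa [flipBit, hn.ne'] using h n hn

theorem zero_notMem_MLR : (fun _ => false : Cantor) ∉ MLR := by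
  intro h
  -- The cylinders of the words `0 ^ i` form a test.
  refine h (fun i => wordCylinder (List.replicate i false))
    ⟨⟨fun i _ => some (List.replicate i false), ?_, fun i => by ext; simp⟩, fun i => ?_⟩ ?_
  · have : Primrec fun x : ℕ × ℕ => some ((List.range x.1).map fun _ => false) :=
      Primrec.option_some.comp (Primrec.list_map (Primrec.list_range.comp .fst) (.const false))
    exact (this.of_eq fun x => by simp [List.map_const']).to_comp
  · have : wordCylinder (List.replicate i false) =
        Set.pi (Finset.range i : Set ℕ) fun _ => {false} := by
      ext x
      simp [wordCylinder, Fin.forall_iff, Set.mem_pi]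
    simp only [this]
    rw [cantorMeasure, MeasureTheory.Measure.infinitePi_pi _ fun _ _ => .singleton _]
    simp
  · simp [wordCylinder]

theorem notMem_MLR_of_eq_false_from {N : ℕ} {x : Cantor} (h : ∀ n ≥ N, x n = false) :
    x ∉ MLR :=
  fun hx => zero_notMem_MLR (mem_MLR_of_eq_from h hx)

theorem IsMLTest.exists_notMem {U : ℕ → Set Cantor} (hU : IsMLTest U) {x : Cantor}
    (hx : x ∈ MLR) : ∃ n, x ∉ U n := by
  simpa using hx U hU

theorem IsUniversalMLTest.mem_of_notMem_MLR {U : ℕ → Set Cantor} (hU : IsUniversalMLTest U)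
    {x : Cantor} (hx : x ∉ MLR) (n : ℕ) : x ∈ U n := by
  rw [MLR_eq_compl hU, Set.notMem_compl_iff] at hx
  exact Set.mem_iInter.1 hx n

/-! ### Enumerating a computable sequence of open sets -/

/-- The word of the first `t` bits of `x`. -/
def initWord (x : Cantor) (t : ℕ) : List Bool := (List.range t).map x

theorem initWord_succ (x : Cantor) (t : ℕ) : initWord x (t + 1) = initWord x t ++ [x t] := by
  simp [initWord, List.range_succ]

theorem prefix_initWord {v : List Bool} {x : Cantor} {t : ℕ} :
    v <+: initWord x t ↔ v.length ≤ t ∧ x ∈ wordCylinder v := by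
  rw [List.prefix_iff_getElem]
  simp only [initWord, List.length_map, List.length_range, List.getElem_map, List.getElem_range,
    wordCylinder, Set.mem_ofPred_eq, Fin.forall_iff, List.get_eq_getElem, exists_prop]
  exact ⟨fun ⟨h, h'⟩ => ⟨h, fun i hi => (h' i hi).symm⟩,
    fun ⟨h, h'⟩ => ⟨h, fun i hi => (h' i hi).symm⟩⟩

/-- Given a listing `e` of words for the open sets `U i`, the test whether the cylinder of the word
`w` is seen to lie in `U i` after `t` steps, namely because one of the first `t` entries of the
list for `U i` is a prefix of `w`. -/
def seenBy (e : ℕ → ℕ → Option (List Bool)) (w : List Bool) (i t : ℕ) : Bool :=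
  decide (∃ j < t, (e i j).elim false (fun v => decide (v <+: w)) = true)

theorem seenBy_initWord {e : ℕ → ℕ → Option (List Bool)} {x : Cantor} {i t : ℕ} :
    seenBy e (initWord x t) i t = true ↔
      ∃ j < t, ∃ w ∈ e i j, w.length ≤ t ∧ x ∈ wordCylinder w := by
  simp only [seenBy, decide_eq_true_eq]
  refine exists_congr fun j => and_congr_right fun _ => ?_
  cases e i j <;> simp [prefix_initWord]

theorem seenBy_initWord_mono {e : ℕ → ℕ → Option (List Bool)} {x : Cantor} {i s t : ℕ}
    (h : seenBy e (initWord x s) i s = true) (hst : s ≤ t) :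
    seenBy e (initWord x t) i t = true := by
  rw [seenBy_initWord] at h ⊢
  obtain ⟨j, hj, w, hw, hl, hx⟩ := h
  exact ⟨j, hj.trans_le hst, w, hw, hl.trans hst, hx⟩

theorem mem_iff_exists_seenBy {e : ℕ → ℕ → Option (List Bool)} {U : ℕ → Set Cantor}
    (hU : ∀ i, U i = {x | ∃ j, ∃ w ∈ e i j, x ∈ wordCylinder w}) {x : Cantor} {i : ℕ} :
    x ∈ U i ↔ ∃ t, seenBy e (initWord x t) i t = true := by
  simp only [hU, Set.mem_ofPred_eq, seenBy_initWord]
  constructor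
  · rintro ⟨j, w, hw, hx⟩
    exact ⟨max (j + 1) w.length, j, by omega, w, hw, le_max_right _ _, hx⟩
  · rintro ⟨t, j, -, w, hw, -, hx⟩
    exact ⟨j, w, hw, hx⟩

theorem OracleComputable.seenBy {α : Type*} [Primcodable α] {e : ℕ → ℕ → Option (List Bool)}
    (he : Computable₂ e) {w : Baire → α → List Bool} {i t : Baire → α → ℕ}
    (hw : OracleComputable w) (hi : OracleComputable i) (ht : OracleComputable t) :
    OracleComputable fun p a => seenBy e (w p a) (i p a) (t p a) := by
  have hpre : Primrec₂ fun v w : List Bool => decide (v <+: w) :=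
    (Primrec.eq.decide.comp (Primrec.fst (α := List Bool) (β := List Bool))
      (Primrec.list_take.comp (Primrec.list_length.comp .fst) .snd)).of_eq
        fun x => by simp [List.prefix_iff_eq_take]
  have htest : Primrec₂ fun (o : Option (List Bool)) (w : List Bool) =>
      o.elim false (fun v => decide (v <+: w)) := by
    refine (Primrec.option_casesOn (.fst (α := Option (List Bool)) (β := List Bool)) (.const false)
      (hpre.comp .snd (Primrec.snd.comp .fst)).to₂).of_eq ?_
    rintro ⟨_ | v, w⟩ <;> rfl
  have fst : OracleComputable fun (_ : Baire) (x : α × ℕ) => x.1 := .of_computable .fst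
  exact ht.exists_lt (f := fun p x => (e (i p x.1) x.2).elim false fun v => decide (v <+: w p x.1))
    (.comp₂ htest.to_comp (.comp₂ he (hi.comp fst) (.of_computable .snd)) (hw.comp fst))

/-- The point of Cantor space with the name `p`. -/
def ofBaire (p : Baire) : Cantor := fun n => decide (p n = 1)

theorem toBaire_ofBaire {p : Baire} (hp : ∀ n, p n ≤ 1) : (ofBaire p).toBaire = p := by
  funext n
  have := hp n
  interval_cases h : p n <;> simp [Cantor.toBaire, ofBaire, h]

theorem ofBaire_toBaire (x : Cantor) : ofBaire x.toBaire = x := by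
  funext n
  cases h : x n <;> simp [Cantor.toBaire, ofBaire, h]

theorem mem_mlrSpace_rep {p : Baire} {x : mlrSpace.carrier} :
    x ∈ mlrSpace.rep p ↔ (∀ n, p n ≤ 1) ∧ x.1 = ofBaire p := by
  constructor
  · rintro ⟨⟨h, -⟩, rfl⟩
    exact ⟨h, rfl⟩
  · rintro ⟨h, hx⟩
    exact ⟨⟨h, show ofBaire p ∈ MLR from hx ▸ x.2⟩, Subtype.ext hx.symm⟩

theorem OracleComputable.initWord : OracleComputable fun p => initWord (ofBaire p) := by
  have h := nat_rec (σ := List Bool) (h := fun p (x : ℕ × ℕ × List Bool) =>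
      x.2.2 ++ [decide (p x.2.1 = 1)]) (of_computable .id) (const [])
    (comp₂ Computable.list_concat (of_computable (Computable.snd.comp .snd))
      (comp₂ Primrec.eq.decide.to_comp (oracle (of_computable (Computable.fst.comp .snd)))
        (const 1)))
  convert h using 3 with p t
  induction t with
  | zero => rfl
  | succ t ih => rw [initWord_succ, ih]; rfl

/-! ### From the least layer to closed choice -/

/-- Stage `m = ⟨a, t⟩` of the enumeration of the complement of the set of all codes `a = ⟨n, s⟩`
such that `x ∉ U n` while `x` is seen in `U i` by stage `s` for all `i < n`, where `x` is the point
with name `p`. -/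
def refuteLeast (e : ℕ → ℕ → Option (List Bool)) (p : Baire) (m : ℕ) : ℕ :=
  bif seenBy e (initWord (ofBaire p) m.unpair.2) m.unpair.1.unpair.1 m.unpair.2 ||
      decide (∃ i < m.unpair.1.unpair.1, (!seenBy e (initWord (ofBaire p) m.unpair.1.unpair.2) i
        m.unpair.1.unpair.2) = true)
  then m.unpair.1 + 1 else 0

theorem not_exists_refuteLeast_eq {e : ℕ → ℕ → Option (List Bool)} {U : ℕ → Set Cantor}
    (hU : ∀ i, U i = {x | ∃ j, ∃ w ∈ e i j, x ∈ wordCylinder w}) {p : Baire} {a : ℕ} :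
    (¬ ∃ m, refuteLeast e p m = a + 1) ↔ ofBaire p ∉ U a.unpair.1 ∧
      ∀ i < a.unpair.1, seenBy e (initWord (ofBaire p) a.unpair.2) i a.unpair.2 = true := by
  rw [mem_iff_exists_seenBy hU]
  simp only [refuteLeast, Bool.cond_eq_ite]
  constructor
  · intro h
    simp only [not_exists] at h ⊢
    refine ⟨fun t ht => h (Nat.pair a t) (by simp [ht]), fun i hi => ?_⟩
    by_contra hs
    refine h (Nat.pair a 0) ?_
    rw [if_pos]
    · simp
    · simpa using Or.inr ⟨i, hi, by simpa using hs⟩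
  · rintro ⟨h, hs⟩ ⟨m, hm⟩
    split_ifs at hm with hc
    obtain rfl : m.unpair.1 = a := by omega
    rw [Bool.or_eq_true, decide_eq_true_eq] at hc
    rcases hc with hc | ⟨i, hi, hc⟩
    · exact h ⟨_, hc⟩
    · simp [hs i hi] at hc

theorem OracleComputable.refuteLeast {e : ℕ → ℕ → Option (List Bool)} (he : Computable₂ e) :
    OracleComputable (refuteLeast e) := by
  have h1 : Computable fun m : ℕ => m.unpair.1 := Computable.fst.comp .unpair
  have h2 : Computable fun m : ℕ => m.unpair.2 := Computable.snd.comp .unpair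
  have h3 : OracleComputable fun (_ : Baire) (x : ℕ × ℕ) => x.1.unpair.1.unpair.2 :=
    of_computable ((h2.comp h1).comp .fst)
  have hin : OracleComputable fun p (m : ℕ) =>
      LayerProblem.seenBy e (LayerProblem.initWord (ofBaire p) m.unpair.2) m.unpair.1.unpair.1
        m.unpair.2 :=
    seenBy he (initWord.comp (of_computable h2)) (of_computable (h1.comp h1)) (of_computable h2)
  have hout : OracleComputable fun p (x : ℕ × ℕ) =>
      !LayerProblem.seenBy e (LayerProblem.initWord (ofBaire p) x.1.unpair.1.unpair.2) x.2
        x.1.unpair.1.unpair.2 :=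
    comp₁ Primrec.not.to_comp (seenBy he (initWord.comp h3) (of_computable .snd) h3)
  have hex := exists_lt (of_computable (h1.comp h1)) hout
  have hor := comp₂ Primrec.or.to_comp hin hex
  exact cond hor (of_computable (Computable.succ.comp h1)) (const 0)

/-- The elements of the set handed to closed choice are the codes `⟨n, s⟩` for which `n` is the
least layer of `x` and `s` a stage confirming that `x ∈ U i` for all `i < n`. The set is nonempty,
and its complement can be listed from `x`. -/
theorem RD_totallyReducible {U : ℕ → Set Cantor} (hU : IsMLTest U) :
    TotallyReducible (RD U) (closedChoiceNat.prod dMLR) := by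
  obtain ⟨e, he, heU⟩ := hU.1
  -- Position `1` of `⟨p, r⟩` holds `r 0`, the number named by the first component of `r`.
  refine ⟨fun s _ => (s 1).unpair.1, fun p => pairing (refuteLeast e p) p,
    .comp₁ (Computable.fst.comp .unpair) (.oracle (.const 1)),
    .pairing (.refuteLeast he) .id, fun p x hx _ => ?_⟩
  obtain ⟨hp, hxp⟩ := mem_mlrSpace_rep.1 hx
  let A : Set ℕ := {a | ¬ ∃ m, refuteLeast e p m = a + 1}
  have hpM : p ∈ Cantor.toBaire '' MLR := ⟨x.1, x.2, by rw [hxp, toBaire_ofBaire hp]⟩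
  refine ⟨(A, ⟨p, hpM⟩), ?_, ?_, ?_⟩
  · refine Part.mem_bind (Part.mem_some_iff.2 ?_) (Part.mem_map _ ?_)
    · rw [pairFst_pairing]
    · exact ⟨⟨trivial, (pairSnd_pairing _ p).symm ▸ hpM⟩, Subtype.ext (pairSnd_pairing _ p)⟩
  · classical
    have hex := hU.exists_notMem x.2
    have hlt : ∀ i, ∃ t, i < Nat.find hex → seenBy e (initWord (ofBaire p) t) i t = true := by
      intro i
      by_cases hi : i < Nat.find hex
      · obtain ⟨t, ht⟩ := (mem_iff_exists_seenBy heU).1 (not_not.1 (Nat.find_min hex hi))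
        exact ⟨t, fun _ => hxp ▸ ht⟩
      · exact ⟨0, fun h => absurd h hi⟩
    choose t ht using hlt
    refine ⟨(Nat.pair (Nat.find hex) ((Finset.range (Nat.find hex)).sup t), ⟨1, rfl⟩), ?_, rfl⟩
    refine (not_exists_refuteLeast_eq heU).2 ?_
    simp only [Nat.unpair_pair]
    exact ⟨hxp ▸ Nat.find_spec hex, fun i hi =>
      seenBy_initWord_mono (ht i hi) (Finset.le_sup (f := t) (Finset.mem_range.2 hi))⟩
  · rintro q ⟨a, b⟩ hab ⟨ha, -⟩
    obtain ⟨a', ha', hab'⟩ := Part.mem_bind_iff.1 hab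
    obtain ⟨b', -, hb'⟩ := (Part.mem_map_iff _).1 hab'
    obtain rfl : a = q 0 := by
      have h : a' = a := congrArg Prod.fst hb'
      exact h.symm.trans (Part.mem_some_iff.1 ha')
    obtain ⟨hn, hs⟩ := (not_exists_refuteLeast_eq heU).1 ha
    refine ⟨(q 0).unpair.1, Part.mem_some_iff.2 (by simp [pairing]), ?_, fun m hm => ?_⟩
    · show x.1 ∉ _
      rwa [hxp]
    · by_contra! hlt
      exact hm (hxp ▸ (mem_iff_exists_seenBy heU).2 ⟨_, hs m hlt⟩)

theorem LAY_totallyReducible_RD (U : ℕ → Set Cantor) : TotallyReducible (LAY U) (RD U) := by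
  classical
  refine ⟨pairSnd, fun p => p, .pairSnd, .id, fun p x hx hxd => ⟨x, hx, ?_, ?_⟩⟩
  · exact ⟨Nat.find hxd, Nat.find_spec hxd, fun m hm => Nat.find_min' hxd hm⟩
  · rintro q y hy hyx
    exact ⟨y, by rwa [pairSnd_pairing], hyx.1⟩

/-! ### From closed choice to layers -/

/-- The guess at stage `s` for an element of the closed set with name `p`: a number is kept until
it is seen to be excluded, and is then replaced by its successor. -/
def guess (p : Baire) (s : ℕ) : ℕ :=
  s.rec 0 fun s g => bif decide (∃ i < s, decide (p i = g + 1) = true) then g + 1 else g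

theorem guess_le_succ (p : Baire) (s : ℕ) : guess p s ≤ guess p (s + 1) := by
  show _ ≤ bif _ then guess p s + 1 else guess p s
  rw [Bool.cond_eq_ite]
  split_ifs <;> omega

theorem exists_guess_eq {p : Baire} (hp : {n | ¬ ∃ i, p i = n + 1}.Nonempty) :
    ∃ a ∈ {n | ¬ ∃ i, p i = n + 1}, ∃ T, ∀ s ≥ T, guess p s = a := by
  obtain ⟨b, hb⟩ := hp
  have hstep : ∀ s, guess p (s + 1) =
      bif decide (∃ i < s, decide (p i = guess p s + 1) = true) then guess p s + 1
      else guess p s := fun _ => rfl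
  have hle : ∀ s, guess p s ≤ b := by
    intro s
    induction s with
    | zero => exact Nat.zero_le b
    | succ s ih =>
      rw [hstep, Bool.cond_eq_ite]
      split_ifs with h
      · rcases ih.lt_or_eq with h' | h'
        · exact h'
        · obtain ⟨i, -, hi⟩ := of_decide_eq_true h
          exact absurd ⟨i, h' ▸ of_decide_eq_true hi⟩ hb
      · exact ih
  -- Being monotone and bounded, the guesses reach their supremum.
  have hbdd : BddAbove (Set.range (guess p)) := ⟨b, Set.forall_mem_range.2 hle⟩
  obtain ⟨T, hT⟩ := Nat.sSup_mem (Set.range_nonempty _) hbdd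
  have hconst : ∀ s ≥ T, guess p s = guess p T := fun s hs =>
    (hT ▸ le_csSup hbdd (Set.mem_range_self s)).antisymm
      (monotone_nat_of_le_succ (guess_le_succ p) hs)
  refine ⟨guess p T, ?_, T, hconst⟩
  rintro ⟨i, hi⟩
  have h1 := hconst (max T (i + 1)) (le_max_left _ _)
  have h2 := hconst (max T (i + 1) + 1) (by omega)
  rw [hstep, h1, Bool.cond_eq_ite, if_pos] at h2
  · omega
  · exact decide_eq_true ⟨i, by omega, decide_eq_true hi⟩


theorem OracleComputable.guess : OracleComputable guess := by
  refine nat_rec (σ := ℕ) (h := fun p (x : ℕ × ℕ × ℕ) =>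
    bif decide (∃ i < x.2.1, decide (p i = x.2.2 + 1) = true) then x.2.2 + 1 else x.2.2)
    (of_computable .id) (const 0) (cond (exists_lt (of_computable (Computable.fst.comp .snd))
      (f := fun p (y : (ℕ × ℕ × ℕ) × ℕ) => decide (p y.2 = y.1.2.2 + 1))
      (comp₂ Primrec.eq.decide.to_comp (oracle (of_computable .snd)) (of_computable ?_)))
      (of_computable ?_) (of_computable ?_))
  · exact Computable.succ.comp (Computable.snd.comp (Computable.snd.comp .fst))
  · exact Computable.succ.comp (Computable.snd.comp .snd)
  · exact Computable.snd.comp .snd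

/-- After `t` steps, with the bits `w` produced so far, some earlier guess `g i` that differs from
the current one is still not punished: `w` is not yet seen to force membership in `U i`. -/
def pending (e : ℕ → ℕ → Option (List Bool)) (g : ℕ → ℕ) (w : List Bool) (t : ℕ) : Bool :=
  decide (∃ i < t, (!decide (g i = g t) && !seenBy e w i t) = true)

/-- If `y` copies `x` except that it has the bit `0` wherever a wrong guess is pending, and the
guesses `g` stabilize to `a`, then `y` is a finite modification of `x`, because a sequence that is
eventually `0` is not random and so lies in every `U i`. Moreover `y` lies in `U i` for every wrong
guess `g i`. -/
theorem mem_MLR_of_pending {U : ℕ → Set Cantor} (hU : IsUniversalMLTest U)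
    {e : ℕ → ℕ → Option (List Bool)}
    (heU : ∀ i, U i = {x | ∃ j, ∃ w ∈ e i j, x ∈ wordCylinder w}) {g : ℕ → ℕ} {a T : ℕ}
    (hg : ∀ s ≥ T, g s = a) {x y : Cantor} (hx : x ∈ MLR)
    (hy : ∀ t, y t = bif pending e g (initWord y t) t then false else x t) :
    y ∈ MLR ∧ ∀ i, g i ≠ a → y ∈ U i := by
  have hlt : ∀ i, g i ≠ a → i < T := fun i hi => by
    by_contra! h
    exact hi (hg i h)
  have hpend : ∀ t ≥ T, pending e g (initWord y t) t = false ↔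
      ∀ i, g i ≠ a → seenBy e (initWord y t) i t = true := by
    intro t ht
    simp only [pending, hg t ht, decide_eq_false_iff_not, not_exists, not_and]
    refine ⟨fun h i hi => ?_, fun h i _ => ?_⟩
    · simpa [hi] using h i ((hlt i hi).trans_le ht)
    · by_cases hi : g i = a
      · simp [hi]
      · simp [h i hi]
  obtain ⟨t₀, ht₀, hfree⟩ : ∃ t ≥ T, pending e g (initWord y t) t = false := by
    by_contra! h
    have hzero : ∀ t ≥ T, y t = false := fun t ht => by
      rw [hy, Bool.eq_true_of_not_eq_false (h t ht), cond_true]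
    -- Now `y` is eventually `0`, so every wrong guess is punished in the end.
    choose s hs using fun i => (mem_iff_exists_seenBy heU).1
      (hU.mem_of_notMem_MLR (notMem_MLR_of_eq_false_from hzero) i)
    let t := max T ((Finset.range T).sup s)
    exact h t (le_max_left _ _) ((hpend t (le_max_left _ _)).2 fun i hi =>
      seenBy_initWord_mono (hs i) ((Finset.le_sup (f := s)
        (Finset.mem_range.2 (hlt i hi))).trans (le_max_right _ _)))
  have hseen := (hpend t₀ ht₀).1 hfree
  refine ⟨mem_MLR_of_eq_from (N := t₀) (fun t ht => ?_) hx,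
    fun i hi => (mem_iff_exists_seenBy heU).2 ⟨t₀, hseen i hi⟩⟩
  rw [hy, (hpend t (ht₀.trans ht)).2 fun i hi => seenBy_initWord_mono (hseen i hi) ht, cond_false]

/-- The first `t` bits of the sequence that copies the point with name `p`, except that it has the
bit `0` wherever a wrong guess is pending. -/
def punishWord (e : ℕ → ℕ → Option (List Bool)) (g : ℕ → ℕ) (p : Baire) (t : ℕ) : List Bool :=
  t.rec [] fun t w => w ++ [bif pending e g w t then false else decide (p t = 1)]

/-- The sequence with the initial words `punishWord e g p t`. -/
def punish (e : ℕ → ℕ → Option (List Bool)) (g : ℕ → ℕ) (p : Baire) : Cantor :=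
  fun t => bif pending e g (punishWord e g p t) t then false else decide (p t = 1)

theorem punishWord_eq_initWord (e : ℕ → ℕ → Option (List Bool)) (g : ℕ → ℕ) (p : Baire) (t : ℕ) :
    punishWord e g p t = initWord (punish e g p) t := by
  induction t with
  | zero => rfl
  | succ t ih => rw [initWord_succ, ← ih]; rfl

theorem punish_apply (e : ℕ → ℕ → Option (List Bool)) (g : ℕ → ℕ) (p : Baire) (t : ℕ) :
    punish e g p t =
      bif pending e g (initWord (punish e g p) t) t then false else ofBaire p t := by
  rw [← punishWord_eq_initWord]
  rfl

theorem OracleComputable.punish {e : ℕ → ℕ → Option (List Bool)} (he : Computable₂ e)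
    {g : Baire → ℕ → ℕ} (hg : OracleComputable g) {F : Baire → Baire} (hF : OracleComputable F) :
    OracleComputable fun p => (punish e (g p) (F p)).toBaire := by
  have hpend : OracleComputable fun p (x : List Bool × ℕ) => pending e (g p) x.1 x.2 := by
    have hw : OracleComputable fun (_ : Baire) (y : (List Bool × ℕ) × ℕ) => y.1.1 :=
      of_computable (Computable.fst.comp .fst)
    have ht : OracleComputable fun (_ : Baire) (y : (List Bool × ℕ) × ℕ) => y.1.2 :=
      of_computable (Computable.snd.comp .fst)
    have hi : OracleComputable fun (_ : Baire) (y : (List Bool × ℕ) × ℕ) => y.2 :=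
      of_computable .snd
    have hne : OracleComputable fun p (y : (List Bool × ℕ) × ℕ) =>
        !decide (g p y.2 = g p y.1.2) :=
      comp₁ Primrec.not.to_comp (comp₂ Primrec.eq.decide.to_comp (hg.comp hi) (hg.comp ht))
    have hseen : OracleComputable fun (_ : Baire) (y : (List Bool × ℕ) × ℕ) =>
        !LayerProblem.seenBy e y.1.1 y.2 y.1.2 :=
      comp₁ Primrec.not.to_comp (seenBy he hw hi ht)
    exact exists_lt (of_computable .snd) (comp₂ Primrec.and.to_comp hne hseen)
  have hbit : OracleComputable fun p (x : List Bool × ℕ) =>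
      bif pending e (g p) x.1 x.2 then false else decide (F p x.2 = 1) :=
    cond hpend (const false)
      (comp₂ Primrec.eq.decide.to_comp (hF.comp (of_computable .snd)) (const 1))
  have hword : OracleComputable fun p => punishWord e (g p) (F p) :=
    nat_rec (σ := List Bool) (h := fun p (x : ℕ × ℕ × List Bool) =>
        x.2.2 ++ [bif pending e (g p) x.2.2 x.2.1 then false else decide (F p x.2.1 = 1)])
      (of_computable .id) (const [])
      (comp₂ Computable.list_concat (of_computable (Computable.snd.comp .snd))
        (hbit.comp (of_computable
          ((Computable.snd.comp .snd).pair (Computable.fst.comp .snd)))))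
  have htoNat : Computable Bool.toNat := (Primrec.dom_finite _).to_comp
  exact comp₁ htoNat (hbit.comp (hword.pair (of_computable .id)))

/-- `LAY U` is applied to the `punish`ed copy of the given random sequence. A layer `n` of this
sequence is not the index of a wrong guess, so the guess at stage `n` lies in the closed set. -/
theorem closedChoiceNat_prod_dMLR_totallyReducible_LAY {U : ℕ → Set Cantor}
    (hU : IsUniversalMLTest U) : TotallyReducible (closedChoiceNat.prod dMLR) (LAY U) := by
  obtain ⟨e, he, heU⟩ := hU.1.1
  -- Position `1` of `⟨r, q⟩` holds `q 0`, the layer named by `q`.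
  refine ⟨fun s => pairing (fun _ => guess (pairFst (pairFst s)) (s 1)) fun _ => 1,
    fun r => (punish e (guess (pairFst r)) (pairSnd r)).toBaire, ?_,
    .punish he (OracleComputable.guess.subst .pairFst) .pairSnd, fun r z hz hzd => ?_⟩
  · exact .pairing (((OracleComputable.guess.subst .pairFst).subst .pairFst).comp
      (.oracle (.const 1))) (.const 1)
  obtain ⟨A, x⟩ := z
  obtain ⟨A', hA', hz⟩ := Part.mem_bind_iff.1 hz
  obtain ⟨x', hx', hz⟩ := (Part.mem_map_iff _).1 hz
  obtain ⟨rfl, rfl⟩ := Prod.ext_iff.1 hz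
  obtain ⟨⟨_, x, hx, hxr⟩, _⟩ := hx'
  obtain ⟨⟨n, _⟩, hn, -⟩ := hzd
  have hA : A' = {n | ¬ ∃ i, pairFst r i = n + 1} := Part.mem_some_iff.1 hA'
  subst hA
  obtain ⟨a, ha, T, hT⟩ := exists_guess_eq ⟨n, hn⟩
  have hxr : ofBaire (pairSnd r) = x := by
    rw [← ofBaire_toBaire x]
    exact congrArg ofBaire hxr.symm
  obtain ⟨hy, hyU⟩ := mem_MLR_of_pending hU heU hT hx
    (y := punish e (guess (pairFst r)) (pairSnd r)) fun t => hxr ▸ punish_apply _ _ _ t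
  refine ⟨⟨_, hy⟩, mem_mlrSpace_rep.2 ⟨fun n => Bool.toNat_le _, (ofBaire_toBaire _).symm⟩,
    hU.1.exists_notMem hy, fun q m hm hmf => ?_⟩
  obtain rfl : m = q 0 := Part.mem_some_iff.1 hm
  have hq : guess (pairFst r) (q 0) = a := by
    by_contra h
    exact hmf (hyU _ h)
  refine ⟨(a, ⟨1, rfl⟩), Part.mem_bind (a := a) (Part.mem_some_iff.2 ?_)
    (Part.mem_map_iff _ |>.2 ⟨⟨1, rfl⟩, ⟨⟨trivial, ?_⟩, Subtype.ext ?_⟩, rfl⟩), ha, rfl⟩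
  · rw [pairFst_pairing, pairFst_pairing]
    exact hq.symm
  · rw [pairSnd_pairing]; rfl
  · exact congrFun (pairSnd_pairing (fun _ => guess (pairFst (pairFst (pairing r q)))
      (pairing r q 1)) fun _ => 1) 0

end LayerProblem

/-! ### The equivalences -/

theorem theorem7 :
    (∀ U : ℕ → Set LayerProblem.Cantor, LayerProblem.IsUniversalMLTest U →
      LayerProblem.WeihrauchEquiv (LayerProblem.LAY U) (LayerProblem.RD U) ∧
      LayerProblem.WeihrauchEquiv (LayerProblem.RD U)
        (LayerProblem.closedChoiceNat.prod LayerProblem.dMLR) ∧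
      LayerProblem.WeihrauchEquiv (LayerProblem.LAY U)
        (LayerProblem.closedChoiceNat.prod LayerProblem.dMLR)) ∧
    (∀ U V : ℕ → Set LayerProblem.Cantor,
      LayerProblem.IsUniversalMLTest U → LayerProblem.IsUniversalMLTest V →
      LayerProblem.WeihrauchEquiv (LayerProblem.LAY U) (LayerProblem.LAY V) ∧
      LayerProblem.WeihrauchEquiv (LayerProblem.RD U) (LayerProblem.RD V)) := by
  have lay_le_rd := LayerProblem.LAY_totallyReducible_RD
  have rd_le {U} (hU : LayerProblem.IsUniversalMLTest U) :=
    LayerProblem.RD_totallyReducible hU.1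
  have lay_le {U} (hU : LayerProblem.IsUniversalMLTest U) := (lay_le_rd U).trans (rd_le hU)
  have le_lay {U} (hU : LayerProblem.IsUniversalMLTest U) :=
    LayerProblem.closedChoiceNat_prod_dMLR_totallyReducible_LAY hU
  have le_rd {U} (hU : LayerProblem.IsUniversalMLTest U) := (le_lay hU).trans (lay_le_rd U)
  refine ⟨fun U hU => ⟨⟨?_, ?_⟩, ⟨?_, ?_⟩, ?_, ?_⟩, fun U V hU hV => ⟨⟨?_, ?_⟩, ?_, ?_⟩⟩
  · exact (lay_le_rd U).weihrauchLE
  · exact ((rd_le hU).trans (le_lay hU)).weihrauchLE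
  · exact (rd_le hU).weihrauchLE
  · exact (le_rd hU).weihrauchLE
  · exact (lay_le hU).weihrauchLE
  · exact (le_lay hU).weihrauchLE
  · exact ((lay_le hU).trans (le_lay hV)).weihrauchLE
  · exact ((lay_le hV).trans (le_lay hU)).weihrauchLE
  · exact ((rd_le hU).trans (le_rd hV)).weihrauchLE
  · exact ((rd_le hV).trans (le_rd hU)).weihrauchLE
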